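/- Let $p\in[1,\infty)$, let $q\in(1,\infty]$ be its Hölder conjugate ($1/p+1/q=1$), let $(\Omega,\mathfrak M,\mu)$ be an arbitrary measure space, and let $\nu$ be counting measure on $\mathbb Z_{\ge 1}$; write $\ell^p=L^p(\nu)$. Let $A\subseteq\mathcal L(L^p(\mu))$ be a (norm-closed) $L^p$-operator algebra. For $x\in\ell^p$, $y\in\ell^q$, $k\in\mathcal L(\ell^p)$ and $a\in\mathcal L(L^p(\mu))$, let $x\otimes a\in\mathcal L(L^p(\mu),L^p(\nu\times\mu))$, $y\otimes a\in\mathcal L(L^p(\nu\times\mu),L^p(\mu))$ and $k\otimes a\in\mathcal L(L^p(\nu\times\mu))$ be the bounded operators determined by $(x\otimes a)\eta=x\otimes a\eta$, $(y\otimes a)(z\otimes\eta)=\big(\sum_n y(n)z(n)\big)a\eta$ and $(k\otimes a)(z\otimes\eta)=kz\otimes a\eta$ for $z\in\ell^p$, $\eta\in L^p(\mu)$. Let $\ell^p\otimes_pA$, $\ell^q\otimes_pA$ and $\mathcal K(\ell^p)\otimes_pA$ be the closed linear spans of the operators $x\otimes a$ ($x\in\ell^p$), $y\otimes a$ ($y\in\ell^q$)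 and $k\otimes a$ ($k$ a compact operator on $\ell^p$), respectively, with $a\in A$. The pair $(\mathsf X,\mathsf Y)=(\ell^p\otimes_pA,\ell^q\otimes_pA)$ is the standard $L^p$-module over $A$: $\mathsf X$ and $\mathsf Y$ are closed subspaces, and $xa\in\mathsf X$, $yx\in A$ and $ay\in\mathsf Y$ for $x\in\mathsf X$, $y\in\mathsf Y$, $a\in A$. Put \[ \mathcal K_A((\mathsf X,\mathsf Y))=\overline{\mathrm{span}}\{xy: x\in\mathsf X,\ y\in\mathsf Y\},\qquad \mathcal L_A((\mathsf X,\mathsf Y))=\{t\in\mathcal L(L^p(\nu\times\mu)): tx\in\mathsf X,\ yt\in\mathsf Y\ \text{for all } x\in\mathsf X,\ y\in\mathsf Y\}. \] (1) If $A$ has a contractive approximate identity (a net $(e_\lambda)$ in $A$ with $\|e_\lambda\|\le 1$ and $\|ae_\lambda-a\|\to0$, $\|e_\lambda a-a\|\to 0$ for all $a\in A$), then, as subalgebras of $\mathcal L(L^p(\nu\times\mu))$, \[ \mathcal K_A\big((\ell^p\otimes_pA,\ell^q\otimes_pA)\big)=\mathcal K(\ell^p)\otimes_pA . \] (2) If in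 addition $A$ sits nondegenerately in $\mathcal L(L^p(\mu))$ (i.e. $\{a\xi : a\in A,\ \xi\in L^p(\mu)\}$ spans a dense subspace of $L^p(\mu)$), then \[ \mathcal L_A\big((\ell^p\otimes_pA,\ell^q\otimes_pA)\big)=M(\mathcal K(\ell^p)\otimes_pA), \] in the following sense. Write $B=\mathcal K(\ell^p)\otimes_pA$. As a subset of $\mathcal L(L^p(\nu\times\mu))$, the left side is the algebra $\{t: tB\subseteq B,\ Bt\subseteq B\}$ of two-sided multipliers of $B$, and $t\mapsto(c\mapsto tc,\ c\mapsto ct)$ is an isometric algebra isomorphism from it onto the multiplier algebra $M(B)$ of double centralizers, that is, of pairs $(L,R)\in\mathcal L(B)\times\mathcal L(B)^{\mathrm{op}}$, with the maximum norm, such that $L(cd)=L(c)d$, $R(cd)=cR(d)$ and $cL(d)=R(c)d$ for all $c,d\in B$. -/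

import Mathlib

open MeasureTheory Filter Topology
open scoped ENNReal

noncomputable section

/-! ### Elementary tensors in `L^p(ν × μ)`, `ν` the counting measure on `ℕ` -/

/-- `ℓ^p`. The countable index set `ℤ_{≥ 1}` is relabelled as `ℕ`. -/
abbrev SeqLp (p : ℝ≥0∞) : Type := lp (fun _ : ℕ => ℂ) p

/-- The product `ν × μ` of counting measure on `ℕ` with an arbitrary measure `μ`. -/
abbrev countProd {Ω : Type*} [MeasurableSpace Ω] (μ : Measure Ω) : Measure (ℕ × Ω) :=
  (Measure.count : Measure ℕ).prod μ

/-- Without any finiteness assumption on `μ`, the measure `ν × μ` is the sum of the copies of `μ`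
on the slices `{n} × Ω`. -/
theorem countProd_eq_sum {Ω : Type*} [MeasurableSpace Ω] (μ : Measure Ω) :
    countProd μ = Measure.sum fun n : ℕ => μ.map (Prod.mk n) := by
  ext s hs
  rw [countProd, Measure.prod, Measure.bind_apply hs (measurable_from_top).aemeasurable,
    lintegral_count, Measure.sum_apply _ hs]

theorem memLp_elemTensor {p : ℝ≥0∞} {Ω : Type*} [MeasurableSpace Ω] {μ : Measure Ω}
    (x : SeqLp p) (η : Lp ℂ p μ) :
    MemLp (fun z : ℕ × Ω => x z.1 * η z.2) p (countProd μ) := by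
  have hη : StronglyMeasurable (η : Ω → ℂ) := Lp.stronglyMeasurable η
  have hx : StronglyMeasurable (fun z : ℕ × Ω => x z.1) :=
    (measurable_from_top (f := fun n : ℕ => x n)).stronglyMeasurable.comp_measurable measurable_fst
  have hf : StronglyMeasurable (fun z : ℕ × Ω => x z.1 * η z.2) :=
    hx.mul (hη.comp_measurable measurable_snd)
  refine ⟨hf.aestronglyMeasurable, ?_⟩
  have hmk : ∀ n : ℕ, Measurable (Prod.mk n : Ω → ℕ × Ω) := fun n => measurable_prodMk_left
  rcases eq_or_ne p 0 with rfl | h0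
  · simp
  rcases eq_or_ne p ⊤ with rfl | ht
  · rw [eLpNorm_exponent_top]
    refine eLpNormEssSup_lt_top_of_ae_bound (C := ‖x‖ * ‖η‖) ?_
    rw [countProd_eq_sum, Measure.ae_sum_iff]
    intro n
    rw [ae_map_iff (hmk n).aemeasurable (measurableSet_le hf.norm.measurable measurable_const)]
    have hb : ∀ᵐ ω ∂μ, ‖η ω‖ₑ ≤ eLpNorm (η : Ω → ℂ) ⊤ μ := by
      rw [eLpNorm_exponent_top]
      exact enorm_ae_le_eLpNormEssSup _ μ
    filter_upwards [hb] with ω hω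
    rw [norm_mul]
    refine mul_le_mul (lp.norm_apply_le_norm ENNReal.top_ne_zero x n) ?_ (norm_nonneg _)
      (norm_nonneg _)
    rw [Lp.norm_def]
    have := ENNReal.toReal_mono (Lp.eLpNorm_ne_top η) hω
    simpa using this
  · rw [eLpNorm_lt_top_iff_lintegral_rpow_enorm_lt_top h0 ht, countProd_eq_sum,
      lintegral_sum_measure]
    have hp : 0 < p.toReal := ENNReal.toReal_pos h0 ht
    have hm : Measurable fun z : ℕ × Ω => ‖x z.1 * η z.2‖ₑ ^ p.toReal :=
      hf.enorm.pow_const _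
    have hI : ∫⁻ ω, ‖η ω‖ₑ ^ p.toReal ∂μ < ⊤ :=
      (eLpNorm_lt_top_iff_lintegral_rpow_enorm_lt_top h0 ht).1 (Lp.eLpNorm_lt_top η)
    have hs : ∑' n, ‖x n‖ₑ ^ p.toReal ≠ ⊤ := by
      have h1 : Summable fun n => ‖x n‖ ^ p.toReal := (lp.memℓp x).summable hp
      have h2 : ∀ n, ‖x n‖ₑ ^ p.toReal = ENNReal.ofReal (‖x n‖ ^ p.toReal) := fun n => by
        rw [← ofReal_norm, ENNReal.ofReal_rpow_of_nonneg (norm_nonneg _) hp.le]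
      simp_rw [h2]
      exact h1.tsum_ofReal_ne_top
    have he : ∀ n, ∫⁻ z, ‖x z.1 * η z.2‖ₑ ^ p.toReal ∂(μ.map (Prod.mk n)) =
        ‖x n‖ₑ ^ p.toReal * ∫⁻ ω, ‖η ω‖ₑ ^ p.toReal ∂μ := fun n => by
      rw [lintegral_map hm (hmk n), ← lintegral_const_mul _ (hη.enorm.pow_const _)]
      simp_rw [enorm_mul, ENNReal.mul_rpow_of_nonneg _ _ hp.le]
    simp_rw [he, ENNReal.tsum_mul_right]
    exact ENNReal.mul_lt_top hs.lt_top hI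

/-- The elementary tensor `x ⊗ η ∈ L^p(ν × μ)`, i.e. the class of `(n, ω) ↦ x(n) η(ω)`. -/
def elemTensor {p : ℝ≥0∞} {Ω : Type*} [MeasurableSpace Ω] {μ : Measure Ω}
    (x : SeqLp p) (η : Lp ℂ p μ) : Lp ℂ p (countProd μ) :=
  (memLp_elemTensor x η).toLp _

/-! ### Closed linear spans -/

section ClosedSpan

variable {E F G : Type*} [NormedAddCommGroup E] [NormedSpace ℂ E]
  [NormedAddCommGroup F] [NormedSpace ℂ F] [NormedAddCommGroup G] [NormedSpace ℂ G]

/-- The closed linear span of a set. -/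
def closedSpan (S : Set E) : Submodule ℂ E := (Submodule.span ℂ S).topologicalClosure

theorem isClosed_closedSpan (S : Set E) : IsClosed (closedSpan S : Set E) :=
  Submodule.isClosed_topologicalClosure _

theorem subset_closedSpan (S : Set E) : S ⊆ closedSpan S :=
  fun _ hx => Submodule.le_topologicalClosure _ (Submodule.subset_span hx)

theorem closedSpan_induct {S : Set E} {M : Submodule ℂ F} (hM : IsClosed (M : Set F))
    (f : E →L[ℂ] F) (h : ∀ x ∈ S, f x ∈ M) : ∀ x ∈ closedSpan S, f x ∈ M := by
  have hle : closedSpan S ≤ M.comap (f : E →ₗ[ℂ] F) :=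
    Submodule.topologicalClosure_minimal _ (Submodule.span_le.2 h) (hM.preimage f.continuous)
  exact fun x hx => hle hx

theorem closedSpan_induct₂ {S : Set E} {T : Set F} {M : Submodule ℂ G}
    (hM : IsClosed (M : Set G)) (f : E →L[ℂ] F →L[ℂ] G)
    (h : ∀ x ∈ S, ∀ y ∈ T, f x y ∈ M) :
    ∀ x ∈ closedSpan S, ∀ y ∈ closedSpan T, f x y ∈ M := fun x hx y hy =>
  closedSpan_induct hM (f.flip y)
    (fun x' hx' => closedSpan_induct hM (f x') (fun y' hy' => h x' hx' y' hy') y hy) x hx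

end ClosedSpan

/-- The closed linear span of a multiplicatively closed set of operators, as an algebra. -/
def closedSpanAlgebra {E : Type*} [NormedAddCommGroup E] [NormedSpace ℂ E]
    (S : Set (E →L[ℂ] E)) (hS : ∀ s ∈ S, ∀ t ∈ S, s * t ∈ S) :
    NonUnitalSubalgebra ℂ (E →L[ℂ] E) where
  __ := closedSpan S
  mul_mem' {a b} ha hb :=
    closedSpan_induct₂ (isClosed_closedSpan S) (ContinuousLinearMap.mul ℂ (E →L[ℂ] E))
      (fun s hs t ht => subset_closedSpan S (hS s hs t ht)) a ha b hb

/-! ### `L^p`-modules and their morphisms -/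

section LpModule

variable {p : ℝ≥0∞} [Fact (1 ≤ p)] {Ω₀ Ω₁ : Type*} [MeasurableSpace Ω₀] [MeasurableSpace Ω₁]

/-- An `L^p`-module `(X, Y)` over an algebra `A` of operators on `L^p(μ₀)`, with
`X ⊆ L(L^p(μ₀), L^p(μ₁))` and `Y ⊆ L(L^p(μ₁), L^p(μ₀))`. -/
structure LpModule {μ₀ : Measure Ω₀} (A : NonUnitalSubalgebra ℂ (Lp ℂ p μ₀ →L[ℂ] Lp ℂ p μ₀))
    (μ₁ : Measure Ω₁) where
  X : Submodule ℂ (Lp ℂ p μ₀ →L[ℂ] Lp ℂ p μ₁)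
  Y : Submodule ℂ (Lp ℂ p μ₁ →L[ℂ] Lp ℂ p μ₀)
  isClosed_X : IsClosed (X : Set (Lp ℂ p μ₀ →L[ℂ] Lp ℂ p μ₁))
  isClosed_Y : IsClosed (Y : Set (Lp ℂ p μ₁ →L[ℂ] Lp ℂ p μ₀))
  right_mem : ∀ x ∈ X, ∀ a ∈ A, x.comp a ∈ X
  pairing_mem : ∀ x ∈ X, ∀ y ∈ Y, y.comp x ∈ A
  left_mem : ∀ y ∈ Y, ∀ a ∈ A, a.comp y ∈ Y

variable {μ₀ : Measure Ω₀} {A : NonUnitalSubalgebra ℂ (Lp ℂ p μ₀ →L[ℂ] Lp ℂ p μ₀)}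
  {μ₁ : Measure Ω₁}

/-- `L_A((X, Y))`: the operators `t` on `L^p(μ₁)` with `t X ⊆ X` and `Y t ⊆ Y`. -/
def LpModule.morphisms (Z : LpModule A μ₁) : Subalgebra ℂ (Lp ℂ p μ₁ →L[ℂ] Lp ℂ p μ₁) where
  carrier := {t | (∀ x ∈ Z.X, t.comp x ∈ Z.X) ∧ ∀ y ∈ Z.Y, y.comp t ∈ Z.Y}
  mul_mem' {s t} hs ht :=
    ⟨fun x hx => hs.1 _ (ht.1 x hx), fun y hy => ht.2 _ (hs.2 y hy)⟩
  add_mem' {s t} hs ht :=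
    ⟨fun x hx => by
      rw [ContinuousLinearMap.add_comp]; exact Z.X.add_mem (hs.1 x hx) (ht.1 x hx),
     fun y hy => by
      rw [ContinuousLinearMap.comp_add]; exact Z.Y.add_mem (hs.2 y hy) (ht.2 y hy)⟩
  algebraMap_mem' r :=
    ⟨fun x hx => Z.X.smul_mem r hx, fun y hy => by
      have h : y.comp (algebraMap ℂ (Lp ℂ p μ₁ →L[ℂ] Lp ℂ p μ₁) r) = r • y := by
        ext1 v
        simp [Algebra.algebraMap_eq_smul_one]
      rw [h]
      exact Z.Y.smul_mem r hy⟩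

/-- `K_A((X, Y))`: the closed linear span of the operators `θ_{x,y} = x y`. -/
def LpModule.compacts (Z : LpModule A μ₁) :
    NonUnitalSubalgebra ℂ (Lp ℂ p μ₁ →L[ℂ] Lp ℂ p μ₁) :=
  closedSpanAlgebra {t | ∃ x ∈ Z.X, ∃ y ∈ Z.Y, t = x.comp y} <| by
    rintro _ ⟨x, hx, y, hy, rfl⟩ _ ⟨x', hx', y', hy', rfl⟩
    exact ⟨x.comp (y.comp x'), Z.right_mem x hx _ (Z.pairing_mem x' hx' y hy), y', hy', rfl⟩

end LpModule

/-! ### Spatial tensor products of operators and the standard module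

Each of the three predicates below singles out the unique bounded operator with the stated values
on elementary tensors (which span a dense subspace of `L^p(ν × μ)` for `p < ∞`). -/

section Tensor

variable {p : ℝ≥0∞} [Fact (1 ≤ p)] {Ω : Type*} [MeasurableSpace Ω] {μ : Measure Ω}

/-- `T = x ⊗ a`, where `x ∈ ℓ^p` is viewed as the operator `z ↦ z x` from `ℂ` to `ℓ^p`, and
`ℂ ⊗_p L^p(μ)` is identified with `L^p(μ)`. -/
def IsVecTensor (x : SeqLp p) (a : Lp ℂ p μ →L[ℂ] Lp ℂ p μ)
    (T : Lp ℂ p μ →L[ℂ] Lp ℂ p (countProd μ)) : Prop :=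
  ∀ η : Lp ℂ p μ, T η = elemTensor x (a η)

/-- `T = y ⊗ b`, where `y ∈ ℓ^q` is viewed as the functional `x ↦ ∑ y(n) x(n)` from `ℓ^p` to `ℂ`,
and `ℂ ⊗_p L^p(μ)` is identified with `L^p(μ)`. -/
def IsCovecTensor {q : ℝ≥0∞} (y : SeqLp q) (b : Lp ℂ p μ →L[ℂ] Lp ℂ p μ)
    (T : Lp ℂ p (countProd μ) →L[ℂ] Lp ℂ p μ) : Prop :=
  ∀ (x : SeqLp p) (η : Lp ℂ p μ), T (elemTensor x η) = (∑' n, y n * x n) • b η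

/-- `T = k ⊗ a` for operators `k` on `ℓ^p` and `a` on `L^p(μ)`. -/
def IsOpTensor (k : SeqLp p →L[ℂ] SeqLp p) (a : Lp ℂ p μ →L[ℂ] Lp ℂ p μ)
    (T : Lp ℂ p (countProd μ) →L[ℂ] Lp ℂ p (countProd μ)) : Prop :=
  ∀ (x : SeqLp p) (η : Lp ℂ p μ), T (elemTensor x η) = elemTensor (k x) (a η)

/-- The standard `L^p`-module `(ℓ^p ⊗_p A, ℓ^q ⊗_p A)` over `A`. -/
def standardLpModule (q : ℝ≥0∞) (A : NonUnitalSubalgebra ℂ (Lp ℂ p μ →L[ℂ] Lp ℂ p μ))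
    (hA : IsClosed (A : Set (Lp ℂ p μ →L[ℂ] Lp ℂ p μ))) : LpModule A (countProd μ) where
  X := closedSpan {T | ∃ x : SeqLp p, ∃ a ∈ A, IsVecTensor x a T}
  Y := closedSpan {T | ∃ y : SeqLp q, ∃ b ∈ A, IsCovecTensor y b T}
  isClosed_X := isClosed_closedSpan _
  isClosed_Y := isClosed_closedSpan _
  right_mem t ht a ha := by
    refine closedSpan_induct (isClosed_closedSpan _)
      ((ContinuousLinearMap.compL ℂ _ _ (Lp ℂ p (countProd μ))).flip a) ?_ t ht
    rintro T ⟨x, a', ha', hT⟩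
    exact subset_closedSpan _ ⟨x, a' * a, A.mul_mem ha' ha, fun η => hT (a η)⟩
  pairing_mem t ht s hs := by
    refine closedSpan_induct₂ (M := A.toSubmodule) hA
      (ContinuousLinearMap.compL ℂ (Lp ℂ p μ) (Lp ℂ p (countProd μ)) (Lp ℂ p μ)) ?_ s hs t ht
    rintro S ⟨y, b, hb, hS⟩ T ⟨x, a, ha, hT⟩
    have h : S.comp T = (∑' n, y n * x n) • (b * a) := by
      ext1 η
      simp [hT η, hS x (a η)]
    change S.comp T ∈ A
    rw [h]
    exact A.toSubmodule.smul_mem _ (A.mul_mem hb ha)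
  left_mem s hs a ha := by
    refine closedSpan_induct (isClosed_closedSpan _)
      (ContinuousLinearMap.compL ℂ (Lp ℂ p (countProd μ)) _ _ a) ?_ s hs
    rintro S ⟨y, b, hb, hS⟩
    refine subset_closedSpan _ ⟨y, a * b, A.mul_mem ha hb, fun x η => ?_⟩
    simp [hS x η]

/-- `K(ℓ^p) ⊗_p A`: the closed linear span in `L(L^p(ν × μ))` of the operators `k ⊗ a` with
`k` a compact operator on `ℓ^p` and `a ∈ A`. -/
def compactTensor (A : NonUnitalSubalgebra ℂ (Lp ℂ p μ →L[ℂ] Lp ℂ p μ)) :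
    NonUnitalSubalgebra ℂ (Lp ℂ p (countProd μ) →L[ℂ] Lp ℂ p (countProd μ)) :=
  closedSpanAlgebra
    {T | ∃ k : SeqLp p →L[ℂ] SeqLp p, IsCompactOperator k ∧ ∃ a ∈ A, IsOpTensor k a T} <| by
    rintro S ⟨k, hk, a, ha, hS⟩ T ⟨k', hk', a', ha', hT⟩
    refine ⟨k * k', hk.comp_clm k', a * a', A.mul_mem ha ha', fun x η => ?_⟩
    change S (T _) = _
    rw [hT, hS]
    rfl

end Tensor

/-! ### Approximate identities, nondegeneracy, multiplier algebras -/

/-- A subalgebra `A` of a normed algebra has a contractive approximate identity. (Nets indexed by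
sets in the universe of the ambient algebra suffice: any such net can be reindexed by pairs of a
finite subset of `A` and a natural number.) -/
def HasContractiveApproxId.{u} {B : Type u} [NormedRing B] [NormedAlgebra ℂ B]
    (A : NonUnitalSubalgebra ℂ B) : Prop :=
  ∃ (Λ : Type u) (_ : Preorder Λ) (_ : IsDirected Λ (· ≤ ·)) (_ : Nonempty Λ) (e : Λ → B),
    (∀ i, e i ∈ A ∧ ‖e i‖ ≤ 1) ∧
    ∀ a ∈ A, Tendsto (fun i => ‖a * e i - a‖) atTop (𝓝 0) ∧
      Tendsto (fun i => ‖e i * a - a‖) atTop (𝓝 0)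

/-- `A ⊆ L(E)` sits nondegenerately: `A E` spans a dense subspace of `E`. -/
def IsNondegenerate {E : Type*} [NormedAddCommGroup E] [NormedSpace ℂ E]
    (A : NonUnitalSubalgebra ℂ (E →L[ℂ] E)) : Prop :=
  Dense (Submodule.span ℂ {η : E | ∃ a ∈ A, ∃ ξ : E, η = a ξ} : Set E)

instance nonUnitalSubalgebraNormedSpace {B : Type*} [NormedRing B] [NormedAlgebra ℂ B]
    (A : NonUnitalSubalgebra ℂ B) : NormedSpace ℂ A where
  norm_smul_le c a := norm_smul_le c (a : B)

/-- The double centralizers `(L, R)` of `B`, as a subalgebra of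
`L(B) × L(B)ᵒᵖ`, which carries the maximum norm. -/
def doubleCentralizers (B : Type*) [NonUnitalNormedRing B] [NormedSpace ℂ B]
    [IsScalarTower ℂ B B] [SMulCommClass ℂ B B] :
    Subalgebra ℂ ((B →L[ℂ] B) × (B →L[ℂ] B)ᵐᵒᵖ) where
  carrier := {m | (∀ a b, m.1 (a * b) = m.1 a * b) ∧
    (∀ a b, m.2.unop (a * b) = a * m.2.unop b) ∧ ∀ a b, a * m.1 b = m.2.unop a * b}
  mul_mem' {m n} hm hn := by
    refine ⟨fun a b => ?_, fun a b => ?_, fun a b => ?_⟩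
    · simp [hn.1, hm.1]
    · simp [hn.2.1, hm.2.1]
    · simp [hm.2.2, hn.2.2]
  add_mem' {m n} hm hn := by
    refine ⟨fun a b => ?_, fun a b => ?_, fun a b => ?_⟩
    · simp [hm.1, hn.1, add_mul]
    · simp [hm.2.1, hn.2.1, mul_add]
    · simp [hm.2.2, hn.2.2, mul_add, add_mul]
  algebraMap_mem' r := by
    refine ⟨fun a b => ?_, fun a b => ?_, fun a b => ?_⟩ <;>
      simp [Algebra.algebraMap_eq_smul_one, smul_mul_assoc, mul_smul_comm]

section MultiplierAlgebra

variable (B : Type*) [NonUnitalNormedRing B] [NormedSpace ℂ B] [IsScalarTower ℂ B B]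
  [SMulCommClass ℂ B B]

/-- The multiplier algebra `M(B)` of double centralizers of `B`, a normed algebra. -/
def MultiplierAlgebra : Type _ := doubleCentralizers B

instance : NormedRing (MultiplierAlgebra B) := inferInstanceAs (NormedRing (doubleCentralizers B))

instance : NormedAlgebra ℂ (MultiplierAlgebra B) :=
  inferInstanceAs (NormedAlgebra ℂ (doubleCentralizers B))

variable {B}

/-- The component `L` of a double centralizer `(L, R)`. -/
def MultiplierAlgebra.left (m : MultiplierAlgebra B) : B →L[ℂ] B := m.1.1

/-- The component `R` of a double centralizer `(L, R)`. -/
def MultiplierAlgebra.right (m : MultiplierAlgebra B) : B →L[ℂ] B := m.1.2.unop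

/-- The norm of `M(B)` is the maximum of the two operator norms. -/
theorem MultiplierAlgebra.norm_eq (m : MultiplierAlgebra B) : ‖m‖ = max ‖m.left‖ ‖m.right‖ := rfl

theorem MultiplierAlgebra.left_mul (m n : MultiplierAlgebra B) :
    (m * n).left = m.left.comp n.left := rfl

theorem MultiplierAlgebra.right_mul (m n : MultiplierAlgebra B) :
    (m * n).right = n.right.comp m.right := rfl

end MultiplierAlgebra

end

noncomputable section

/-! ### Slices of functions on `ℕ × Ω` -/

section Slices

variable {p : ℝ≥0∞} {Ω : Type*} [MeasurableSpace Ω] {μ : Measure Ω}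

/-! Since `ν × μ` is the sum of the copies of `μ` on the slices, `L^p(ν × μ)` sits isometrically in
`ℓ^p(L^p(μ))`, for arbitrary `μ`. Everything is expressed through the coordinate maps `slice n` and
the embeddings `incl n`. Write `B = K(ℓ^p) ⊗_p A`, let `P_N` be the coordinate projections and
`(e_λ)` the approximate identity of `A`.

The key object is `P_N ⊗ e_λ = ∑_{n<N} incl n ∘ e_λ ∘ slice n` (`truncTensor`). As `‖k ⊗ a‖ ≤ ‖k‖
‖a‖` and `P_N k → k` in norm for compact `k`, it is a contractive left approximate identity of `B`.
Only the left side is used: for `p = 1`, `k P_N → k` can fail.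

For (1), `(x ⊗ a)(y ⊗ b)` is a rank-one operator tensored with `ab`, so `XY ⊆ B`. Conversely `T = k
⊗ a` is the limit of the sums of `(incl n ∘ e_λ)(slice n ∘ T)`, whose factors lie in `X` and `Y`,
the second because the rows of `k` lie in `(ℓ^p)* = ℓ^q`.

For (2), by (1) a module morphism multiplies `B = K_A` into itself. A multiplier `t` of `B`
preserves `X` because `t x = (t (x ∘ slice 0)) ∘ incl 0` with `x ∘ slice 0 ∈ B`, and similarly for
`Y`. Nondegeneracy makes `P_N ⊗ e_λ` converge strongly to `1`, so a double centralizer `(L, R)`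
comes from the strong limit of `L (P_N ⊗ e_λ)` (`exists_algEquiv_multiplierAlgebra`). -/

theorem map_prodMk_le_countProd (μ : Measure Ω) (n : ℕ) : μ.map (Prod.mk n) ≤ countProd μ := by
  rw [countProd_eq_sum]
  exact Measure.le_sum _ n

theorem ae_slice_of_ae_countProd {P : ℕ × Ω → Prop} (h : ∀ᵐ z ∂countProd μ, P z) (n : ℕ) :
    ∀ᵐ ω ∂μ, P (n, ω) :=
  ae_of_ae_map measurable_prodMk_left.aemeasurable
    ((Measure.absolutelyContinuous_of_le (map_prodMk_le_countProd μ n)).ae_le h)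

theorem memLp_slice (F : Lp ℂ p (countProd μ)) (n : ℕ) : MemLp (fun ω => F (n, ω)) p μ :=
  ((Lp.memLp F).mono_measure (map_prodMk_le_countProd μ n)).comp_of_map
    measurable_prodMk_left.aemeasurable

theorem lintegral_countProd {f : ℕ × Ω → ℝ≥0∞} (hf : Measurable f) :
    ∫⁻ z, f z ∂countProd μ = ∑' n, ∫⁻ ω, f (n, ω) ∂μ := by
  rw [countProd_eq_sum, lintegral_sum_measure]
  exact tsum_congr fun n => lintegral_map hf measurable_prodMk_left

theorem norm_toLp_slice_le (F : Lp ℂ p (countProd μ)) (n : ℕ) :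
    ‖(memLp_slice F n).toLp _‖ ≤ ‖F‖ := by
  rw [Lp.norm_toLp, Lp.norm_def]
  refine ENNReal.toReal_mono (Lp.eLpNorm_ne_top F) ?_
  have h : eLpNorm F p (μ.map (Prod.mk n)) = eLpNorm (fun ω => F (n, ω)) p μ :=
    eLpNorm_map_measure (Lp.stronglyMeasurable F).aestronglyMeasurable
      measurable_prodMk_left.aemeasurable
  exact h.ge.trans (eLpNorm_mono_measure F (map_prodMk_le_countProd μ n))

variable [Fact (1 ≤ p)]

/-- The slice `F ↦ F(n, ·)`, as a bounded operator. -/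
def slice (n : ℕ) : Lp ℂ p (countProd μ) →L[ℂ] Lp ℂ p μ :=
  LinearMap.mkContinuous
    { toFun := fun F => (memLp_slice F n).toLp _
      map_add' := fun F G => by
        rw [← MemLp.toLp_add, MemLp.toLp_eq_toLp_iff]
        exact ae_slice_of_ae_countProd (Lp.coeFn_add F G) n
      map_smul' := fun c F => by
        rw [RingHom.id_apply, ← MemLp.toLp_const_smul, MemLp.toLp_eq_toLp_iff]
        exact ae_slice_of_ae_countProd (Lp.coeFn_smul c F) n }
    1 fun F => by
      rw [one_mul]
      exact norm_toLp_slice_le F n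

theorem coeFn_slice (n : ℕ) (F : Lp ℂ p (countProd μ)) :
    slice n F =ᵐ[μ] fun ω => F (n, ω) :=
  (memLp_slice F n).coeFn_toLp

theorem slice_elemTensor (n : ℕ) (x : SeqLp p) (η : Lp ℂ p μ) :
    slice n (elemTensor x η) = x n • η := by
  refine Lp.ext ?_
  have h := ae_slice_of_ae_countProd (MemLp.coeFn_toLp (memLp_elemTensor x η)) n
  filter_upwards [coeFn_slice n (elemTensor x η), h, Lp.coeFn_smul (x n) η] with ω h1 h2 h3
  rw [h1, h3]
  exact h2

theorem enorm_rpow_eq_lintegral {α : Type*} [MeasurableSpace α] {m : Measure α} (hp : p ≠ ⊤)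
    (F : Lp ℂ p m) : ‖F‖ₑ ^ p.toReal = ∫⁻ z, ‖F z‖ₑ ^ p.toReal ∂m := by
  have h0 : p ≠ 0 := (zero_lt_one.trans_le Fact.out).ne'
  rw [Lp.enorm_def, eLpNorm_eq_lintegral_rpow_enorm_toReal h0 hp, ← ENNReal.rpow_mul,
    one_div_mul_cancel (ENNReal.toReal_pos h0 hp).ne', ENNReal.rpow_one]

theorem enorm_rpow_eq_tsum_slice (hp : p ≠ ⊤) (F : Lp ℂ p (countProd μ)) :
    ‖F‖ₑ ^ p.toReal = ∑' n, ‖slice n F‖ₑ ^ p.toReal := by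
  rw [enorm_rpow_eq_lintegral hp,
    lintegral_countProd ((Lp.stronglyMeasurable F).enorm.pow_const _)]
  refine tsum_congr fun n => ?_
  rw [enorm_rpow_eq_lintegral hp]
  refine lintegral_congr_ae ?_
  filter_upwards [coeFn_slice n F] with ω h
  rw [h]

theorem hasSum_norm_slice (hp : p ≠ ⊤) (F : Lp ℂ p (countProd μ)) :
    HasSum (fun n => ‖slice n F‖ ^ p.toReal) (‖F‖ ^ p.toReal) := by
  have h := enorm_rpow_eq_tsum_slice hp F
  have hf := ENNReal.hasSum_toReal (f := fun n => ‖slice n F‖ₑ ^ p.toReal)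
    (h ▸ ENNReal.rpow_ne_top_of_nonneg ENNReal.toReal_nonneg enorm_ne_top)
  rw [← ENNReal.tsum_toReal_eq fun n => by finiteness, ← h] at hf
  simpa only [← ENNReal.toReal_rpow, toReal_enorm] using hf

theorem toReal_pos_of_ne_top (hp : p ≠ ⊤) : 0 < p.toReal :=
  ENNReal.toReal_pos (zero_lt_one.trans_le Fact.out).ne' hp

/-- The isometry `F ↦ (F(n, ·))ₙ` of `L^p(ν × μ)` into `ℓ^p(L^p(μ))`. -/
def slices (hp : p ≠ ⊤) : Lp ℂ p (countProd μ) →ₗᵢ[ℂ] lp (fun _ : ℕ => Lp ℂ p μ) p where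
  toFun F := ⟨fun n => slice n F, memℓp_gen (hasSum_norm_slice hp F).summable⟩
  map_add' F G := by ext1; funext n; exact map_add (slice n) F G
  map_smul' c F := by ext1; funext n; exact map_smul (slice n) c F
  norm_map' F := by
    have h0 := toReal_pos_of_ne_top hp
    refine (Real.rpow_left_inj (norm_nonneg _) (norm_nonneg _) h0.ne').1 ?_
    rw [lp.norm_rpow_eq_tsum h0]
    exact (hasSum_norm_slice hp F).tsum_eq

theorem slices_apply (hp : p ≠ ⊤) (F : Lp ℂ p (countProd μ)) (n : ℕ) :
    slices hp F n = slice n F := rfl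

theorem ext_slice (hp : p ≠ ⊤) {F G : Lp ℂ p (countProd μ)} (h : ∀ n, slice n F = slice n G) :
    F = G :=
  (slices hp).injective (lp.ext (funext h))

theorem norm_elemTensor (hp : p ≠ ⊤) (x : SeqLp p) (η : Lp ℂ p μ) :
    ‖elemTensor x η‖ = ‖x‖ * ‖η‖ := by
  have h0 := toReal_pos_of_ne_top hp
  refine (Real.rpow_left_inj (norm_nonneg _) (by positivity) h0.ne').1 ?_
  rw [← (hasSum_norm_slice hp _).tsum_eq, Real.mul_rpow (norm_nonneg _) (norm_nonneg _),
    lp.norm_rpow_eq_tsum h0, ← tsum_mul_right]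
  refine tsum_congr fun n => ?_
  rw [slice_elemTensor, norm_smul, Real.mul_rpow (norm_nonneg _) (norm_nonneg _)]

/-- The embedding `η ↦ x ⊗ η` of `L^p(μ)` in `L^p(ν × μ)`. -/
def tensorLeft (hp : p ≠ ⊤) (x : SeqLp p) : Lp ℂ p μ →L[ℂ] Lp ℂ p (countProd μ) :=
  LinearMap.mkContinuous
    { toFun := elemTensor x
      map_add' := fun η θ => ext_slice hp fun n => by simp [slice_elemTensor]
      map_smul' := fun c η => ext_slice hp fun n => by
        simp [slice_elemTensor, smul_comm c (x n) η] }
    ‖x‖ fun η => (norm_elemTensor hp x η).le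

theorem tensorLeft_apply (hp : p ≠ ⊤) (x : SeqLp p) (η : Lp ℂ p μ) :
    tensorLeft hp x η = elemTensor x η := rfl

/-- The embedding of `L^p(μ)` in `L^p(ν × μ)` as the functions supported on the `n`-th slice. -/
def incl (hp : p ≠ ⊤) (n : ℕ) : Lp ℂ p μ →L[ℂ] Lp ℂ p (countProd μ) :=
  tensorLeft hp (lp.single p n 1)

theorem incl_apply (hp : p ≠ ⊤) (n : ℕ) (η : Lp ℂ p μ) :
    incl hp n η = elemTensor (lp.single p n 1) η := rfl

theorem slice_incl (hp : p ≠ ⊤) (m n : ℕ) (η : Lp ℂ p μ) :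
    slice m (incl hp n η) = if m = n then η else 0 := by
  rw [incl_apply, slice_elemTensor, lp.single_apply]
  split_ifs with h
  · subst h; simp
  · simp [h]

theorem slices_incl (hp : p ≠ ⊤) (n : ℕ) (η : Lp ℂ p μ) :
    slices hp (incl hp n η) = lp.single p n η := by
  ext1
  funext m
  rw [slices_apply, slice_incl, lp.single_apply]
  split_ifs with h
  · subst h; simp
  · simp [h]

/-- An isometric embedding reflects convergence of series, so this follows from the expansion of a
vector of `ℓ^p(L^p(μ))` in its coordinates, valid for `p < ∞`. -/
theorem hasSum_incl_slice (hp : p ≠ ⊤) (F : Lp ℂ p (countProd μ)) :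
    HasSum (fun n => incl hp n (slice n F)) F := by
  rw [← (slices hp).isometry.isEmbedding.isInducing.hasSum_iff (g := slices hp)]
  convert lp.hasSum_single hp (slices hp F) using 1
  funext n
  exact slices_incl hp n _

theorem elemTensor_add_left (hp : p ≠ ⊤) (x y : SeqLp p) (η : Lp ℂ p μ) :
    elemTensor (x + y) η = elemTensor x η + elemTensor y η :=
  ext_slice hp fun n => by simp [slice_elemTensor, add_smul]

theorem elemTensor_sub_left (hp : p ≠ ⊤) (x y : SeqLp p) (η : Lp ℂ p μ) :
    elemTensor (x - y) η = elemTensor x η - elemTensor y η :=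
  ext_slice hp fun n => by simp [slice_elemTensor, sub_smul]

theorem elemTensor_smul_left (hp : p ≠ ⊤) (c : ℂ) (x : SeqLp p) (η : Lp ℂ p μ) :
    elemTensor (c • x) η = elemTensor x (c • η) :=
  ext_slice hp fun n => by simp [slice_elemTensor, mul_smul, smul_comm c (x n) η]

/-- Tonelli: the norm is computed over the fibres `ℕ × {ω}` instead of over the slices. One factor
is countable, so exchanging a series with an integral suffices and `μ` need not be σ-finite. -/
theorem enorm_sum_elemTensor {ι : Type*} (hp : p ≠ ⊤) (s : Finset ι) (z : ι → SeqLp p)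
    (η : ι → Lp ℂ p μ) :
    ‖∑ i ∈ s, elemTensor (z i) (η i)‖ₑ ^ p.toReal =
      ∫⁻ ω, ‖∑ i ∈ s, η i ω • z i‖ₑ ^ p.toReal ∂μ := by
  have h0 := toReal_pos_of_ne_top hp
  have hm : ∀ n, Measurable fun ω => ‖∑ i ∈ s, z i n * η i ω‖ₑ ^ p.toReal := fun n =>
    ((Finset.stronglyMeasurable_fun_sum s fun i _ =>
      (Lp.stronglyMeasurable (η i)).const_mul (z i n)).enorm).pow_const _
  have hs : ∀ n, ‖slice n (∑ i ∈ s, elemTensor (z i) (η i))‖ₑ ^ p.toReal =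
      ∫⁻ ω, ‖∑ i ∈ s, z i n * η i ω‖ₑ ^ p.toReal ∂μ := fun n => by
    rw [enorm_rpow_eq_lintegral hp]
    refine lintegral_congr_ae ?_
    have h1 : slice n (∑ i ∈ s, elemTensor (z i) (η i)) = ∑ i ∈ s, z i n • η i := by
      simp [slice_elemTensor]
    have h2 : ∀ᵐ ω ∂μ, ∀ i ∈ s, (z i n • η i : Lp ℂ p μ) ω = z i n * η i ω :=
      (Finset.eventually_all s).2 fun i _ => Lp.coeFn_smul (z i n) (η i)
    rw [h1]
    filter_upwards [Lp.coeFn_finsetSum s fun i => z i n • η i, h2] with ω h3 h4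
    rw [h3, Finset.sum_apply, Finset.sum_congr rfl h4]
  rw [enorm_rpow_eq_tsum_slice hp, tsum_congr hs, ← lintegral_tsum fun n => (hm n).aemeasurable]
  refine lintegral_congr fun ω => ?_
  have h3 := lp.hasSum_norm h0 (∑ i ∈ s, η i ω • z i)
  rw [← ofReal_norm, ENNReal.ofReal_rpow_of_nonneg (norm_nonneg _) h0.le, ← h3.tsum_eq,
    ENNReal.ofReal_tsum_of_nonneg (fun _ => by positivity) h3.summable]
  refine tsum_congr fun n => ?_
  have h4 : (∑ i ∈ s, η i ω • z i : SeqLp p) n = ∑ i ∈ s, z i n * η i ω := by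
    rw [lp.coeFn_sum, Finset.sum_apply]
    exact Finset.sum_congr rfl fun i _ => mul_comm _ _
  rw [← ofReal_norm, ENNReal.ofReal_rpow_of_nonneg (norm_nonneg _) h0.le, h4]

/-- This is the bound for `k ⊗ 1`: for each fixed `ω`, the operator `k` acts on one vector of `ℓ^p`.
-/
theorem norm_sum_elemTensor_map_le {ι : Type*} (hp : p ≠ ⊤) (k : SeqLp p →L[ℂ] SeqLp p)
    (s : Finset ι) (z : ι → SeqLp p) (η : ι → Lp ℂ p μ) :
    ‖∑ i ∈ s, elemTensor (k (z i)) (η i)‖ ≤ ‖k‖ * ‖∑ i ∈ s, elemTensor (z i) (η i)‖ := by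
  have h0 := toReal_pos_of_ne_top hp
  suffices h : ‖∑ i ∈ s, elemTensor (k (z i)) (η i)‖ₑ ≤
      ‖k‖ₑ * ‖∑ i ∈ s, elemTensor (z i) (η i)‖ₑ by
    have := ENNReal.toReal_mono (by finiteness) h
    simpa using this
  rw [← ENNReal.rpow_le_rpow_iff h0, ENNReal.mul_rpow_of_nonneg _ _ h0.le,
    enorm_sum_elemTensor hp, enorm_sum_elemTensor hp,
    ← lintegral_const_mul' _ _ (by finiteness)]
  refine lintegral_mono fun ω => ?_
  rw [← ENNReal.mul_rpow_of_nonneg _ _ h0.le]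
  refine ENNReal.rpow_le_rpow ?_ h0.le
  have : ∑ i ∈ s, η i ω • k (z i) = k (∑ i ∈ s, η i ω • z i) := by simp
  rw [this]
  exact k.le_opENorm _

/-- This is the bound for `1 ⊗ a`, which acts on each slice separately, and the `p`-th powers of the
slice norms add up. -/
theorem norm_sum_incl_map_le (hp : p ≠ ⊤) (a : Lp ℂ p μ →L[ℂ] Lp ℂ p μ) (s : Finset ℕ)
    (η : ℕ → Lp ℂ p μ) :
    ‖∑ n ∈ s, incl hp n (a (η n))‖ ≤ ‖a‖ * ‖∑ n ∈ s, incl hp n (η n)‖ := by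
  have h0 := toReal_pos_of_ne_top hp
  have h : ∀ θ : ℕ → Lp ℂ p μ,
      ‖∑ n ∈ s, incl hp n (θ n)‖ ^ p.toReal = ∑ n ∈ s, ‖θ n‖ ^ p.toReal := fun θ => by
    rw [← (slices hp).norm_map, map_sum]
    simp_rw [slices_incl]
    exact lp.norm_sum_single h0 θ s
  rw [← Real.rpow_le_rpow_iff (norm_nonneg _) (by positivity) h0,
    Real.mul_rpow (norm_nonneg _) (norm_nonneg _), h, h, Finset.mul_sum]
  refine Finset.sum_le_sum fun n _ => ?_
  rw [← Real.mul_rpow (norm_nonneg _) (norm_nonneg _)]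
  exact Real.rpow_le_rpow (norm_nonneg _) (a.le_opNorm _) h0.le

/-- The spatial tensor product of operators is contractive: `‖k ⊗ a‖ ≤ ‖k‖ ‖a‖`. -/
theorem IsOpTensor.norm_le (hp : p ≠ ⊤) {k : SeqLp p →L[ℂ] SeqLp p}
    {a : Lp ℂ p μ →L[ℂ] Lp ℂ p μ} {T : Lp ℂ p (countProd μ) →L[ℂ] Lp ℂ p (countProd μ)}
    (hT : IsOpTensor k a T) : ‖T‖ ≤ ‖k‖ * ‖a‖ := by
  refine T.opNorm_le_bound (by positivity) fun F => ?_
  -- The factorization `k ⊗ a = (k ⊗ 1)(1 ⊗ a)` is estimated on the partial sums of the slice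
  -- expansion, and the bound passes to the limit.
  have hF := hasSum_incl_slice hp F
  refine le_of_tendsto_of_tendsto' (hF.mapL T).norm (hF.norm.const_mul (‖k‖ * ‖a‖)) fun s => ?_
  calc ‖∑ n ∈ s, T (incl hp n (slice n F))‖
      = ‖∑ n ∈ s, elemTensor (k (lp.single p n 1)) (a (slice n F))‖ := by
        simp_rw [incl_apply, hT _ _]
    _ ≤ ‖k‖ * ‖∑ n ∈ s, elemTensor (lp.single p n 1) (a (slice n F))‖ :=
        norm_sum_elemTensor_map_le hp k s _ _
    _ ≤ ‖k‖ * (‖a‖ * ‖∑ n ∈ s, incl hp n (slice n F)‖) := by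
        gcongr
        exact norm_sum_incl_map_le hp a s _
    _ = _ := (mul_assoc _ _ _).symm

end Slices

/-! ### Strong convergence of bounded families of operators -/

section StrongConvergence

variable {ι E F : Type*} [NormedAddCommGroup E] [NormedSpace ℂ E]
  [NormedAddCommGroup F] [NormedSpace ℂ F] {l : Filter ι}

/-- A norm-bounded family is equicontinuous, so convergence to a continuous limit is a closed
condition on the point. -/
theorem isClosed_setOf_tendsto_of_norm_le {C : ℝ} {g : ι → E →L[ℂ] F} (hg : ∀ i, ‖g i‖ ≤ C)
    (h : E →L[ℂ] F) : IsClosed {x | Tendsto (fun i => g i x) l (𝓝 (h x))} := by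
  have hC : ∃ C, ∀ i, ‖g i‖ ≤ C := ⟨C, hg⟩
  have he : Equicontinuous ((↑) ∘ g : ι → E → F) :=
    ((NormedSpace.equicontinuous_TFAE g).out 5 1).1 hC
  exact he.isClosed_setOfPred_tendsto h.continuous

theorem tendsto_of_mem_closedSpan {C : ℝ} {g : ι → E →L[ℂ] F} (hg : ∀ i, ‖g i‖ ≤ C)
    (h : E →L[ℂ] F) {S : Set E} (hS : ∀ x ∈ S, Tendsto (fun i => g i x) l (𝓝 (h x))) :
    ∀ x ∈ closedSpan S, Tendsto (fun i => g i x) l (𝓝 (h x)) := by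
  let M : Submodule ℂ E :=
    { carrier := {x | Tendsto (fun i => g i x) l (𝓝 (h x))}
      add_mem' := fun {x y} hx hy => by
        simpa only [Set.mem_ofPred_eq, map_add] using Tendsto.add hx hy
      zero_mem' := by simp [tendsto_const_nhds]
      smul_mem' := fun c x hx => by
        simpa only [Set.mem_ofPred_eq, map_smul] using Tendsto.const_smul hx c }
  have hle : closedSpan S ≤ M := Submodule.topologicalClosure_minimal _ (Submodule.span_le.2 hS)
    (isClosed_setOf_tendsto_of_norm_le hg h)
  exact fun x hx => hle hx

/-- Strong convergence of contractions is uniform on compact sets, in particular on one containing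
the image of the unit ball under `k`. -/
theorem IsCompactOperator.tendsto_comp {g : ι → F →L[ℂ] F} (hg : ∀ i, ‖g i‖ ≤ 1)
    (h : ∀ y, Tendsto (fun i => g i y) l (𝓝 y)) {k : E →L[ℂ] F} (hk : IsCompactOperator k) :
    Tendsto (fun i => (g i).comp k) l (𝓝 k) := by
  obtain ⟨K, hK, hkK⟩ := IsCompactOperator.image_closedBall_subset_compact
    (f := (k : E →ₗ[ℂ] F)) hk 1
  rw [Metric.tendsto_nhds]
  intro ε hε
  obtain ⟨t, -, ht, hKt⟩ := hK.finite_cover_balls (e := ε / 4) (by positivity)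
  have hev : ∀ᶠ i in l, ∀ y ∈ t, dist (g i y) y < ε / 4 :=
    (eventually_all_finite ht).2 fun y _ => Metric.tendsto_nhds.1 (h y) _ (by positivity)
  filter_upwards [hev] with i hi
  -- Three errors of at most `ε / 4` each leave room for the strict inequality.
  suffices hn : ‖(g i).comp k - k‖ ≤ 3 * (ε / 4) by
    rw [dist_eq_norm]
    linarith
  refine ContinuousLinearMap.opNorm_le_of_unit_norm (by positivity) fun x hx => ?_
  have hkx : k x ∈ K := hkK ⟨x, by simp [hx], rfl⟩
  obtain ⟨y, hy, hxy⟩ := Set.mem_iUnion₂.1 (hKt hkx)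
  rw [Metric.mem_ball, dist_eq_norm] at hxy
  have h1 : ‖g i (k x - y)‖ ≤ ε / 4 :=
    ((g i).le_of_opNorm_le (hg i) _).trans (by rw [one_mul]; exact hxy.le)
  have h2 := hi y hy
  rw [dist_eq_norm] at h2
  have h3 : ((g i).comp k - k) x = g i (k x - y) + (g i y - y) - (k x - y) := by
    simp
  rw [h3]
  calc _ ≤ ‖g i (k x - y)‖ + ‖g i y - y‖ + ‖k x - y‖ :=
        (norm_sub_le _ _).trans (add_le_add_left (norm_add_le _ _) _)
    _ ≤ _ := by linarith

end StrongConvergence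

/-! ### The multiplier algebra of an algebra of operators -/

section Multipliers

variable {E : Type*} [NormedAddCommGroup E] [NormedSpace ℂ E]
  {B : NonUnitalSubalgebra ℂ (E →L[ℂ] E)}

theorem MultiplierAlgebra.ext {B : Type*} [NonUnitalNormedRing B] [NormedSpace ℂ B]
    [IsScalarTower ℂ B B] [SMulCommClass ℂ B B] {m n : MultiplierAlgebra B}
    (hl : ∀ c, m.left c = n.left c) (hr : ∀ c, m.right c = n.right c) : m = n :=
  Subtype.ext (Prod.ext (ContinuousLinearMap.ext hl)
    (MulOpposite.unop_injective (ContinuousLinearMap.ext hr)))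

/-- The bounded operators on a normed algebra, with respect to the module structure coming from the
norm. -/
abbrev EndCLM (B : Type*) [NonUnitalNormedRing B] [NormedSpace ℂ B] : Type _ := B →L[ℂ] B

theorem MultiplierAlgebra.norm_left_apply_le {B : Type*} [NonUnitalNormedRing B] [NormedSpace ℂ B]
    [IsScalarTower ℂ B B] [SMulCommClass ℂ B B] (m : MultiplierAlgebra B) (c : B) :
    ‖m.left c‖ ≤ ‖m‖ * ‖c‖ :=
  m.left.le_of_opNorm_le ((le_max_left _ _).trans_eq m.norm_eq.symm) c

theorem MultiplierAlgebra.norm_le_of_forall {B : Type*} [NonUnitalNormedRing B] [NormedSpace ℂ B]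
    [IsScalarTower ℂ B B] [SMulCommClass ℂ B B] (m : MultiplierAlgebra B) {C : ℝ} (hC : 0 ≤ C)
    (hl : ∀ c, ‖m.left c‖ ≤ C * ‖c‖) (hr : ∀ c, ‖m.right c‖ ≤ C * ‖c‖) : ‖m‖ ≤ C := by
  rw [m.norm_eq]
  exact max_le (m.left.opNorm_le_bound hC hl) (m.right.opNorm_le_bound hC hr)

/-- Left multiplication by `t` on `B`. -/
def mulLeftOn (t : E →L[ℂ] E) (ht : ∀ c ∈ B, t * c ∈ B) : EndCLM B :=
  LinearMap.mkContinuous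
    { toFun := fun c => ⟨t * c, ht c c.2⟩
      map_add' := fun c d => Subtype.ext (mul_add t (c : E →L[ℂ] E) d)
      map_smul' := fun r c => Subtype.ext (mul_smul_comm r t (c : E →L[ℂ] E)) }
    ‖t‖ fun c => norm_mul_le t (c : E →L[ℂ] E)

/-- Right multiplication by `t` on `B`. -/
def mulRightOn (t : E →L[ℂ] E) (ht : ∀ c ∈ B, c * t ∈ B) : EndCLM B :=
  LinearMap.mkContinuous
    { toFun := fun c => ⟨c * t, ht c c.2⟩
      map_add' := fun c d => Subtype.ext (add_mul (c : E →L[ℂ] E) d t)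
      map_smul' := fun r c => Subtype.ext (smul_mul_assoc r (c : E →L[ℂ] E) t) }
    ‖t‖ fun c => (norm_mul_le (c : E →L[ℂ] E) t).trans_eq (mul_comm _ _)

/-- The double centralizer of a two-sided multiplier. -/
def centralizerOf (t : E →L[ℂ] E) (ht : ∀ c ∈ B, t * c ∈ B ∧ c * t ∈ B) : MultiplierAlgebra B :=
  ⟨(mulLeftOn t fun c hc => (ht c hc).1, MulOpposite.op (mulRightOn t fun c hc => (ht c hc).2)),
    fun a b => Subtype.ext (mul_assoc t (a : E →L[ℂ] E) b).symm,
    fun a b => Subtype.ext (mul_assoc (a : E →L[ℂ] E) b t),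
    fun a b => Subtype.ext (mul_assoc (a : E →L[ℂ] E) t b).symm⟩

theorem norm_centralizerOf_le (t : E →L[ℂ] E) (ht : ∀ c ∈ B, t * c ∈ B ∧ c * t ∈ B) :
    ‖centralizerOf t ht‖ ≤ ‖t‖ := by
  exact MultiplierAlgebra.norm_le_of_forall _ (norm_nonneg t)
    (fun c => norm_mul_le t (c : E →L[ℂ] E))
    (fun c => (norm_mul_le (c : E →L[ℂ] E) t).trans_eq (mul_comm _ _))

/-- The map from two-sided multipliers of `B` to double centralizers of `B`. -/
def toMultiplierAlgebra (D : Subalgebra ℂ (E →L[ℂ] E))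
    (hD : ∀ t ∈ D, ∀ c ∈ B, t * c ∈ B ∧ c * t ∈ B) : D →ₐ[ℂ] MultiplierAlgebra B :=
  AlgHom.ofLinearMap
    { toFun := fun t => centralizerOf t (hD t t.2)
      map_add' := fun s t => MultiplierAlgebra.ext
        (fun c => Subtype.ext (add_mul (s : E →L[ℂ] E) t c))
        (fun c => Subtype.ext (mul_add (c : E →L[ℂ] E) s t))
      map_smul' := fun r t => MultiplierAlgebra.ext
        (fun c => Subtype.ext (smul_mul_assoc r (t : E →L[ℂ] E) c))
        (fun c => Subtype.ext (mul_smul_comm r (c : E →L[ℂ] E) t)) }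
    (MultiplierAlgebra.ext (fun c => Subtype.ext (one_mul (c : E →L[ℂ] E)))
      (fun c => Subtype.ext (mul_one (c : E →L[ℂ] E))))
    (fun s t => MultiplierAlgebra.ext
      (fun c => Subtype.ext (mul_assoc (s : E →L[ℂ] E) t c))
      (fun c => Subtype.ext (mul_assoc (c : E →L[ℂ] E) s t).symm))

variable {ι : Type*} {l : Filter ι} [l.NeBot] {f : ι → B}

/-- Let `i` grow in `‖t (f i) ξ‖ ≤ C ‖ξ‖`. This gives the lower bound that makes the map to the
multiplier algebra isometric. -/
theorem norm_le_of_forall_norm_mul_le (hf : ∀ i, ‖f i‖ ≤ 1)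
    (hfE : ∀ ξ, Tendsto (fun i => (f i : E →L[ℂ] E) ξ) l (𝓝 ξ)) (t : E →L[ℂ] E)
    {C : ℝ} (hC : 0 ≤ C) (h : ∀ c : B, ‖t * c‖ ≤ C * ‖c‖) : ‖t‖ ≤ C := by
  refine t.opNorm_le_bound hC fun ξ => ?_
  refine le_of_tendsto ((t.continuous.tendsto ξ).comp (hfE ξ)).norm
    (Eventually.of_forall fun i => ?_)
  exact (t * f i : E →L[ℂ] E).le_of_opNorm_le
    ((h (f i)).trans (mul_le_of_le_one_right hC (hf i))) ξ

/-- A left centralizer of an algebra with a bounded left approximate identity converging strongly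
to `1` is given by an operator. -/
theorem exists_eq_mul_of_left_centralizer [CompleteSpace E] (hf : ∀ i, ‖f i‖ ≤ 1)
    (hfB : ∀ b : B, Tendsto (fun i => f i * b) l (𝓝 b))
    (hfE : ∀ ξ, Tendsto (fun i => (f i : E →L[ℂ] E) ξ) l (𝓝 ξ))
    (L : EndCLM B) {C : ℝ} (hC : 0 ≤ C) (hLC : ∀ c, ‖L c‖ ≤ C * ‖c‖)
    (hL : ∀ a b, L (a * b) = L a * b) :
    ∃ t : E →L[ℂ] E, ∀ c, (L c : E →L[ℂ] E) = t * c := by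
  have hbd : ∀ i, ‖(L (f i) : E →L[ℂ] E)‖ ≤ C := fun i =>
    (hLC (f i)).trans (mul_le_of_le_one_right hC (hf i))
  -- On vectors `b ξ` the limit is known, since `L (f i) b = L (f i * b)` and `L` is continuous.
  have hlim : ∀ (b : B) (ξ : E), Tendsto (fun i => (L (f i) : E →L[ℂ] E) ((b : E →L[ℂ] E) ξ)) l
      (𝓝 ((L b : E →L[ℂ] E) ξ)) := fun b ξ => by
    have h1 : Tendsto (fun i => (L (f i * b) : E →L[ℂ] E) ξ) l (𝓝 ((L b : E →L[ℂ] E) ξ)) :=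
      (((ContinuousLinearMap.apply ℂ E ξ).continuous.comp
        (continuous_subtype_val.comp L.continuous)).tendsto b).comp (hfB b)
    exact h1.congr fun i => congrArg (fun c : B => (c : E →L[ℂ] E) ξ) (hL (f i) b)
  have hc : ∀ ξ, ∃ η, Tendsto (fun i => (L (f i) : E →L[ℂ] E) ξ) l (𝓝 η) := fun ξ => by
    refine cauchy_map_iff_exists_tendsto.1 ?_
    rw [Metric.cauchy_iff]
    refine ⟨inferInstance, fun ε hε => ?_⟩
    -- Replacing `ξ` by `f j ξ`, where convergence is known, costs at most `C` times this, hence at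
    -- most `ε / 4`. The `+ 1` covers `C = 0`.
    have hpos : 0 < ε / (4 * (C + 1)) := by positivity
    obtain ⟨j, hj⟩ := (Metric.tendsto_nhds.1 (hfE ξ) _ hpos).exists
    have hev := Metric.tendsto_nhds.1 (hlim (f j) ξ) (ε / 4) (by positivity)
    refine ⟨_, image_mem_map hev, ?_⟩
    have key : ∀ i, dist ((L (f i) : E →L[ℂ] E) ((f j : E →L[ℂ] E) ξ)) ((L (f j) : E →L[ℂ] E) ξ)
        < ε / 4 → dist ((L (f i) : E →L[ℂ] E) ξ) ((L (f j) : E →L[ℂ] E) ξ) < ε / 2 := by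
      intro i hi
      have h2 : dist ((L (f i) : E →L[ℂ] E) ξ) ((L (f i) : E →L[ℂ] E) ((f j : E →L[ℂ] E) ξ)) ≤
          ε / 4 := by
        rw [dist_eq_norm, ← map_sub]
        refine ((L (f i) : E →L[ℂ] E).le_of_opNorm_le (hbd i) _).trans ?_
        rw [dist_comm, dist_eq_norm, lt_div_iff₀ (by positivity)] at hj
        nlinarith [norm_nonneg (ξ - (f j : E →L[ℂ] E) ξ)]
      linarith [dist_triangle ((L (f i) : E →L[ℂ] E) ξ)
        ((L (f i) : E →L[ℂ] E) ((f j : E →L[ℂ] E) ξ)) ((L (f j) : E →L[ℂ] E) ξ)]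
    rintro _ ⟨i, hi, rfl⟩ _ ⟨i', hi', rfl⟩
    linarith [dist_triangle_right ((L (f i) : E →L[ℂ] E) ξ) ((L (f i') : E →L[ℂ] E) ξ)
      ((L (f j) : E →L[ℂ] E) ξ), key i hi, key i' hi']
  choose t ht using hc
  have hrange : Bornology.IsBounded (Set.range fun i => (L (f i) : E →L[ℂ] E)) :=
    isBounded_iff_forall_norm_le.2 ⟨C, by rintro _ ⟨i, rfl⟩; exact hbd i⟩
  refine ⟨ContinuousLinearMap.ofTendstoOfBoundedRange t (fun i => (L (f i) : E →L[ℂ] E))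
    (tendsto_pi_nhds.2 ht) hrange, fun c => ?_⟩
  ext1 ξ
  exact tendsto_nhds_unique (hlim c ξ) (ht _)

/-- If `B` has a contractive left approximate identity which converges strongly to the identity
operator, then its two-sided multipliers are its double centralizers. -/
theorem exists_algEquiv_multiplierAlgebra [CompleteSpace E] (hf : ∀ i, ‖f i‖ ≤ 1)
    (hfB : ∀ b : B, Tendsto (fun i => f i * b) l (𝓝 b))
    (hfE : ∀ ξ, Tendsto (fun i => (f i : E →L[ℂ] E) ξ) l (𝓝 ξ))
    (D : Subalgebra ℂ (E →L[ℂ] E))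
    (hD : (D : Set (E →L[ℂ] E)) = {t | ∀ c ∈ B, t * c ∈ B ∧ c * t ∈ B}) :
    ∃ Φ : D ≃ₐ[ℂ] MultiplierAlgebra B, (∀ t, ‖Φ t‖ = ‖t‖) ∧
      ∀ t (c : B), ((Φ t).left c : E →L[ℂ] E) = t.1 * c ∧
        ((Φ t).right c : E →L[ℂ] E) = c * t.1 := by
  have hD' : ∀ t, t ∈ D ↔ ∀ c ∈ B, t * c ∈ B ∧ c * t ∈ B := fun t => by
    rw [← SetLike.mem_coe, hD, Set.mem_ofPred_eq]
  let Φ := toMultiplierAlgebra D fun t ht => (hD' t).1 ht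
  have hΦl : ∀ t (c : B), ((Φ t).left c : E →L[ℂ] E) = t.1 * c := fun _ _ => rfl
  have hΦr : ∀ t (c : B), ((Φ t).right c : E →L[ℂ] E) = c * t.1 := fun _ _ => rfl
  have hnorm : ∀ t, ‖Φ t‖ = ‖t‖ := fun t => by
    refine le_antisymm (norm_centralizerOf_le t.1 ((hD' t).1 t.2)) ?_
    exact norm_le_of_forall_norm_mul_le hf hfE t.1 (norm_nonneg _) (Φ t).norm_left_apply_le
  have hinj : Function.Injective Φ := (injective_iff_map_eq_zero Φ).2 fun t h => by
    rw [← norm_eq_zero (a := t), ← hnorm, h, norm_zero]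
  have hsurj : Function.Surjective Φ := fun m => by
    obtain ⟨t, ht⟩ := exists_eq_mul_of_left_centralizer hf hfB hfE m.left
      (norm_nonneg m) m.norm_left_apply_le m.2.1
    -- The operator found from `L` also implements `R`: `R(c) f i = c L(f i) = c t f i`, and `f i →
    -- 1` strongly. No right approximate identity is needed.
    have hr : ∀ c : B, (m.right c : E →L[ℂ] E) = c * t := fun c => by
      ext1 ξ
      have h : ∀ i, (m.right c : E →L[ℂ] E) ((f i : E →L[ℂ] E) ξ) =
          (c * t : E →L[ℂ] E) ((f i : E →L[ℂ] E) ξ) := fun i => by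
        have h1 : (c * m.left (f i) : E →L[ℂ] E) = m.right c * f i :=
          congrArg Subtype.val (m.2.2.2 c (f i))
        rw [ht, ← mul_assoc] at h1
        exact (DFunLike.congr_fun h1 ξ).symm
      refine tendsto_nhds_unique
        (((m.right c : E →L[ℂ] E).continuous.tendsto ξ).comp (hfE ξ)) ?_
      simpa only [Function.comp_def, h] using
        ((c * t : E →L[ℂ] E).continuous.tendsto ξ).comp (hfE ξ)
    have htD : t ∈ D := (hD' t).2 fun c hc =>
      ⟨ht ⟨c, hc⟩ ▸ (m.left ⟨c, hc⟩).2, hr ⟨c, hc⟩ ▸ (m.right ⟨c, hc⟩).2⟩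
    exact ⟨⟨t, htD⟩, MultiplierAlgebra.ext (fun c => Subtype.ext (ht c).symm)
      (fun c => Subtype.ext (hr c).symm)⟩
  exact ⟨AlgEquiv.ofBijective Φ ⟨hinj, hsurj⟩, hnorm, fun t c => ⟨hΦl t c, hΦr t c⟩⟩

end Multipliers

/-! ### Duality and truncations on `ℓ^p` -/

section Sequences

variable {p q : ℝ≥0∞} [Fact (1 ≤ p)]

theorem exists_clm_eq_tsum_mul (hpq : p.HolderConjugate q) (y : SeqLp q) :
    ∃ φ : SeqLp p →L[ℂ] ℂ, ∀ x, φ x = ∑' n, y n * x n := by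
  have : q.HolderConjugate p := hpq.symm
  have : Fact (1 ≤ q) := ⟨ENNReal.HolderConjugate.one_le q p⟩
  refine ⟨lp.dualPairing q p (fun _ => ContinuousLinearMap.mul ℂ ℂ) (K := 1) (fun _ => ?_) y,
    fun x => rfl⟩
  exact ContinuousLinearMap.opNorm_mul_le ℂ ℂ

/-- Converse Hölder: on each finite set of coordinates, `φ` is tested against the vector for which
Hölder's inequality is an equality. -/
theorem memℓp_apply_single (hp : p ≠ ⊤) (hpq : p.HolderConjugate q) (φ : SeqLp p →L[ℂ] ℂ) :
    Memℓp (fun n => φ (lp.single p n 1)) q := by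
  set y : ℕ → ℂ := fun n => φ (lp.single p n 1) with hy
  have hp0 : 0 < p := zero_lt_one.trans_le Fact.out
  rcases eq_or_ne q ⊤ with rfl | hq
  · refine memℓp_infty ⟨‖φ‖, ?_⟩
    rintro _ ⟨n, rfl⟩
    refine (φ.le_opNorm _).trans_eq ?_
    rw [lp.norm_single hp0, norm_one, mul_one]
  have hr : p.toReal.HolderConjugate q.toReal := ENNReal.HolderConjugate.toReal_of_ne_top hp hq
  have hr0 := hr.pos
  have hr1 := hr.symm.pos
  refine memℓp_gen' (C := ‖φ‖ ^ q.toReal) fun s => ?_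
  set S := ∑ i ∈ s, ‖y i‖ ^ q.toReal with hS
  have hS0 : 0 ≤ S := Finset.sum_nonneg fun i _ => by positivity
  -- A zero sum is set apart because a factor `S ^ (1 / p)` is cancelled below.
  rcases hS0.eq_or_lt with h0 | h0
  · rw [← h0]
    positivity
  -- The extremal vector: `z y = |y|^q` and `|z|^p = |y|^((q-1)p) = |y|^q`. Where `y i = 0`,
  -- division by zero gives `z i = 0`.
  let z : ℕ → ℂ := fun i => ((‖y i‖ ^ q.toReal : ℝ) : ℂ) / y i
  have hz1 : ∀ i, z i * y i = ((‖y i‖ ^ q.toReal : ℝ) : ℂ) := fun i => by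
    rcases eq_or_ne (y i) 0 with h | h
    · simp [z, h, Real.zero_rpow hr1.ne']
    · exact div_mul_cancel₀ _ h
  have hz2 : ∀ i, ‖z i‖ ^ p.toReal = ‖y i‖ ^ q.toReal := fun i => by
    rcases eq_or_ne (y i) 0 with h | h
    · simp [z, h, Real.zero_rpow hr1.ne', Real.zero_rpow hr0.ne']
    · have h1 : 0 < ‖y i‖ := norm_pos_iff.2 h
      have h2 : ‖z i‖ = ‖y i‖ ^ (q.toReal - 1) := by
        rw [Real.rpow_sub_one h1.ne']
        simp [z, abs_of_nonneg (Real.rpow_nonneg h1.le q.toReal)]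
      rw [h2, ← Real.rpow_mul h1.le, hr.symm.sub_one_mul_conj]
  have hX := lp.norm_sum_single (E := fun _ : ℕ => ℂ) hr0 z s
  set X : SeqLp p := ∑ i ∈ s, lp.single p i (z i) with hXdef
  rw [Finset.sum_congr rfl fun i _ => hz2 i] at hX
  have hφ : φ X = (S : ℂ) := by
    rw [hXdef, map_sum, hS, Complex.ofReal_sum]
    refine Finset.sum_congr rfl fun i _ => ?_
    have : lp.single p i (z i) = z i • (lp.single p i 1 : SeqLp p) := by
      rw [← lp.single_smul, smul_eq_mul, mul_one]
    rw [this, map_smul, smul_eq_mul]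
    exact hz1 i
  have hle : S ≤ ‖φ‖ * ‖X‖ := by
    have := φ.le_opNorm X
    rwa [hφ, Complex.norm_of_nonneg hS0] at this
  have hXS : ‖X‖ = S ^ (1 / p.toReal) := by
    rw [hS, ← hX, ← Real.rpow_mul (norm_nonneg _), mul_one_div_cancel hr0.ne', Real.rpow_one]
  -- By `1/p + 1/q = 1`, the inequality `S ≤ ‖φ‖ S^(1/p)` becomes `S^(1/q) ≤ ‖φ‖`, a bound
  -- independent of `s`.
  have hsplit : S = S ^ (1 / q.toReal) * S ^ (1 / p.toReal) := by
    rw [← Real.rpow_add h0, one_div, one_div, add_comm, hr.inv_add_inv_eq_one, Real.rpow_one]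
  have h3 : S ^ (1 / q.toReal) ≤ ‖φ‖ := by
    refine le_of_mul_le_mul_right ?_ (Real.rpow_pos_of_pos h0 (1 / p.toReal))
    rw [← hsplit, ← hXS]
    exact hle
  calc S = (S ^ (1 / q.toReal)) ^ q.toReal := by
        rw [← Real.rpow_mul hS0, one_div_mul_cancel hr1.ne', Real.rpow_one]
    _ ≤ _ := Real.rpow_le_rpow (by positivity) h3 hr1.le

/-- Every bounded functional on `ℓ^p`, `p < ∞`, is given by an element of `ℓ^q`. -/
theorem exists_tsum_mul_eq_clm (hp : p ≠ ⊤) (hpq : p.HolderConjugate q) (φ : SeqLp p →L[ℂ] ℂ) :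
    ∃ y : SeqLp q, ∀ x, φ x = ∑' n, y n * x n := by
  refine ⟨⟨_, memℓp_apply_single hp hpq φ⟩, fun x => ?_⟩
  rw [← ((lp.hasSum_single hp x).mapL φ).tsum_eq]
  refine tsum_congr fun n => ?_
  have : lp.single p n (x n) = x n • (lp.single p n 1 : SeqLp p) := by
    rw [← lp.single_smul, smul_eq_mul, mul_one]
  rw [this, map_smul, smul_eq_mul]
  exact mul_comm _ _

/-- The projection of `ℓ^p` onto the first `N` coordinates. -/
def seqTrunc (p : ℝ≥0∞) [Fact (1 ≤ p)] (N : ℕ) : SeqLp p →L[ℂ] SeqLp p :=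
  ∑ n ∈ Finset.range N, (lp.evalCLM ℂ (fun _ : ℕ => ℂ) p n).smulRight (lp.single p n 1)

theorem seqTrunc_apply (N : ℕ) (x : SeqLp p) :
    seqTrunc p N x = ∑ n ∈ Finset.range N, lp.single p n (x n) := by
  rw [seqTrunc, sum_apply]
  refine Finset.sum_congr rfl fun n _ => ?_
  change x n • (lp.single p n 1 : SeqLp p) = _
  rw [← lp.single_smul, smul_eq_mul, mul_one]

theorem norm_seqTrunc_le (hp : p ≠ ⊤) (N : ℕ) : ‖seqTrunc p N‖ ≤ 1 := by
  have h0 := toReal_pos_of_ne_top hp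
  refine ContinuousLinearMap.opNorm_le_bound _ zero_le_one fun x => ?_
  rw [one_mul, ← Real.rpow_le_rpow_iff (norm_nonneg _) (norm_nonneg _) h0, seqTrunc_apply,
    lp.norm_sum_single h0 (fun n => x n)]
  exact lp.sum_rpow_le_norm_rpow h0 x _

theorem tendsto_seqTrunc (hp : p ≠ ⊤) (x : SeqLp p) :
    Tendsto (fun N => seqTrunc p N x) atTop (𝓝 x) := by
  simp_rw [seqTrunc_apply]
  exact (lp.hasSum_single hp x).tendsto_sum_nat

theorem isCompactOperator_smulRight {E F : Type*} [NormedAddCommGroup E] [NormedSpace ℂ E]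
    [NormedAddCommGroup F] [NormedSpace ℂ F] (φ : E →L[ℂ] ℂ) (x : F) :
    IsCompactOperator (φ.smulRight x) :=
  (isCompactOperator_of_locallyCompactSpace_dom φ).clm_comp
    (ContinuousLinearMap.toSpanSingleton ℂ x)

end Sequences

/-! ### Calculus of tensor products of operators -/

section TensorCalculus

variable {p : ℝ≥0∞} [Fact (1 ≤ p)] {Ω : Type*} [MeasurableSpace Ω] {μ : Measure Ω}
  {k k' : SeqLp p →L[ℂ] SeqLp p} {a b : Lp ℂ p μ →L[ℂ] Lp ℂ p μ}
  {S T : Lp ℂ p (countProd μ) →L[ℂ] Lp ℂ p (countProd μ)}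

theorem IsOpTensor.mul (hS : IsOpTensor k a S) (hT : IsOpTensor k' b T) :
    IsOpTensor (k * k') (a * b) (S * T) := fun x η => by
  change S (T _) = _
  rw [hT, hS]
  rfl

theorem IsOpTensor.sub_left (hp : p ≠ ⊤) (hS : IsOpTensor k a S) (hT : IsOpTensor k' a T) :
    IsOpTensor (k - k') a (S - T) := fun x η => by
  rw [sub_apply, hS, hT, sub_apply,
    elemTensor_sub_left hp]

theorem IsOpTensor.sub_right (hp : p ≠ ⊤) (hS : IsOpTensor k a S) (hT : IsOpTensor k b T) :
    IsOpTensor k (a - b) (S - T) := fun x η => by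
  rw [sub_apply, hS, hT, sub_apply,
    ← tensorLeft_apply hp, ← tensorLeft_apply hp, ← tensorLeft_apply hp, map_sub]

/-- The operator `P_N ⊗ a`, with `P_N` the projection onto the first `N` coordinates. -/
def truncTensor (hp : p ≠ ⊤) (N : ℕ) (a : Lp ℂ p μ →L[ℂ] Lp ℂ p μ) :
    Lp ℂ p (countProd μ) →L[ℂ] Lp ℂ p (countProd μ) :=
  ∑ n ∈ Finset.range N, (incl hp n).comp (a.comp (slice n))

theorem isOpTensor_incl_comp_slice (hp : p ≠ ⊤) (n : ℕ) (a : Lp ℂ p μ →L[ℂ] Lp ℂ p μ) :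
    IsOpTensor ((lp.evalCLM ℂ (fun _ : ℕ => ℂ) p n).smulRight (lp.single p n 1)) a
      ((incl hp n).comp (a.comp (slice n))) := fun x η => by
  change incl hp n (a (slice n (elemTensor x η))) =
    elemTensor (x n • (lp.single p n 1 : SeqLp p)) (a η)
  rw [slice_elemTensor, map_smul, elemTensor_smul_left hp, incl_apply]

theorem elemTensor_sum_left {ι : Type*} (hp : p ≠ ⊤) (s : Finset ι) (x : ι → SeqLp p)
    (η : Lp ℂ p μ) : elemTensor (∑ i ∈ s, x i) η = ∑ i ∈ s, elemTensor (x i) η :=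
  map_sum (AddMonoidHom.mk' (fun x : SeqLp p => elemTensor x η)
    fun x y => elemTensor_add_left hp x y η) x s

theorem isOpTensor_truncTensor (hp : p ≠ ⊤) (N : ℕ) (a : Lp ℂ p μ →L[ℂ] Lp ℂ p μ) :
    IsOpTensor (seqTrunc p N) a (truncTensor hp N a) := fun x η => by
  rw [truncTensor, seqTrunc, sum_apply, sum_apply,
    elemTensor_sum_left hp]
  exact Finset.sum_congr rfl fun n _ => isOpTensor_incl_comp_slice hp n a x η

theorem norm_truncTensor_le (hp : p ≠ ⊤) (N : ℕ) (a : Lp ℂ p μ →L[ℂ] Lp ℂ p μ) :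
    ‖truncTensor hp N a‖ ≤ ‖a‖ :=
  ((isOpTensor_truncTensor hp N a).norm_le hp).trans
    (mul_le_of_le_one_left (norm_nonneg _) (norm_seqTrunc_le hp N))

theorem truncTensor_incl (hp : p ≠ ⊤) {n N : ℕ} (h : n < N) (a : Lp ℂ p μ →L[ℂ] Lp ℂ p μ)
    (η : Lp ℂ p μ) : truncTensor hp N a (incl hp n η) = incl hp n (a η) := by
  rw [truncTensor, sum_apply, Finset.sum_eq_single_of_mem n
    (Finset.mem_range.2 h) fun m _ hm => ?_]
  · simp [slice_incl]
  · simp [slice_incl, hm]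

/-- The difference splits through `P_N ⊗ 1` as `P_N k ⊗ (e a - a) + (P_N k - k) ⊗ a`. The norm of
the first term is bounded uniformly in `N`, so the limit is joint in `N` and the index of `e`. -/
theorem IsOpTensor.tendsto_truncTensor_mul {Λ : Type*} {l : Filter Λ} (hp : p ≠ ⊤)
    {e : Λ → Lp ℂ p μ →L[ℂ] Lp ℂ p μ} (hea : Tendsto (fun i => ‖e i * a - a‖) l (𝓝 0))
    (hk : IsCompactOperator k) (hT : IsOpTensor k a T) :
    Tendsto (fun i : ℕ × Λ => truncTensor hp i.1 (e i.2) * T) (atTop ×ˢ l) (𝓝 T) := by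
  have hk' : Tendsto (fun N => ‖seqTrunc p N * k - k‖) atTop (𝓝 0) :=
    tendsto_iff_norm_sub_tendsto_zero.1
      (hk.tendsto_comp (norm_seqTrunc_le hp) (tendsto_seqTrunc hp))
  rw [tendsto_iff_norm_sub_tendsto_zero]
  have hlim : Tendsto (fun i : ℕ × Λ => ‖k‖ * ‖e i.2 * a - a‖ + ‖seqTrunc p i.1 * k - k‖ * ‖a‖)
      (atTop ×ˢ l) (𝓝 0) := by
    simpa using ((hea.comp tendsto_snd).const_mul ‖k‖).add
      ((hk'.comp tendsto_fst).mul_const ‖a‖)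
  refine squeeze_zero (fun _ => norm_nonneg _) (fun ⟨N, i⟩ => ?_) hlim
  have h1 := (isOpTensor_truncTensor hp N (e i)).mul hT
  have h2 := (isOpTensor_truncTensor hp N (1 : Lp ℂ p μ →L[ℂ] Lp ℂ p μ)).mul hT
  rw [one_mul] at h2
  have h3 : ‖seqTrunc p N * k‖ ≤ ‖k‖ := (norm_mul_le _ _).trans
    (mul_le_of_le_one_left (norm_nonneg _) (norm_seqTrunc_le hp N))
  calc ‖truncTensor hp N (e i) * T - T‖
      ≤ ‖truncTensor hp N (e i) * T - truncTensor hp N 1 * T‖ +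
        ‖truncTensor hp N 1 * T - T‖ := norm_sub_le_norm_sub_add_norm_sub _ _ _
    _ ≤ ‖seqTrunc p N * k‖ * ‖e i * a - a‖ + ‖seqTrunc p N * k - k‖ * ‖a‖ :=
        add_le_add ((h1.sub_right hp h2).norm_le hp) ((h2.sub_left hp hT).norm_le hp)
    _ ≤ _ := by gcongr

/-- By the uniform bound it suffices to test vectors `incl n (a ξ)`: the slices span a dense
subspace of `L^p(ν × μ)`, and the vectors `a ξ` one of `L^p(μ)` by nondegeneracy. -/
theorem tendsto_truncTensor_apply {Λ : Type*} {l : Filter Λ} (hp : p ≠ ⊤)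
    {A : NonUnitalSubalgebra ℂ (Lp ℂ p μ →L[ℂ] Lp ℂ p μ)} (hA : IsNondegenerate A)
    {e : Λ → Lp ℂ p μ →L[ℂ] Lp ℂ p μ} (he : ∀ i, ‖e i‖ ≤ 1)
    (hea : ∀ a ∈ A, Tendsto (fun i => ‖e i * a - a‖) l (𝓝 0)) (F : Lp ℂ p (countProd μ)) :
    Tendsto (fun i : ℕ × Λ => truncTensor hp i.1 (e i.2) F) (atTop ×ˢ l) (𝓝 F) := by
  have hbd : ∀ i : ℕ × Λ, ‖truncTensor hp i.1 (e i.2)‖ ≤ 1 := fun i =>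
    (norm_truncTensor_le hp _ _).trans (he _)
  have hincl : ∀ n (η : Lp ℂ p μ), Tendsto
      (fun i : ℕ × Λ => truncTensor hp i.1 (e i.2) (incl hp n η)) (atTop ×ˢ l)
      (𝓝 (incl hp n η)) := fun n η => by
    refine tendsto_of_mem_closedSpan (C := 1 * ‖(incl hp n : Lp ℂ p μ →L[ℂ] _)‖)
      (g := fun i : ℕ × Λ => (truncTensor hp i.1 (e i.2)).comp (incl hp n))
      (fun i => (ContinuousLinearMap.opNorm_comp_le _ _).trans (by gcongr; exact hbd i))
      (incl hp n) (S := {η | ∃ a ∈ A, ∃ ξ, η = a ξ}) ?_ η ?_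
    · rintro _ ⟨a, ha, ξ, rfl⟩
      have h1 : Tendsto (fun i => (e i * a) ξ) l (𝓝 (a ξ)) :=
        ((ContinuousLinearMap.apply ℂ _ ξ).continuous.tendsto a).comp
          (tendsto_iff_norm_sub_tendsto_zero.2 (hea a ha))
      refine ((((incl hp n).continuous.tendsto _).comp h1).comp
        (tendsto_snd (f := atTop))).congr' ?_
      -- Once `N > n` the truncation leaves the `n`-th slice alone, and only `e` acts.
      filter_upwards [tendsto_fst.eventually (eventually_gt_atTop n)] with i hi
      exact (truncTensor_incl hp hi (e i.2) (a ξ)).symm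
    · exact hA η
  refine tendsto_of_mem_closedSpan hbd (ContinuousLinearMap.id ℂ _)
    (S := {G | ∃ (n : ℕ) (η : Lp ℂ p μ), G = incl hp n η}) ?_ F ?_
  · rintro _ ⟨n, η, rfl⟩
    exact hincl n η
  · refine (isClosed_closedSpan _).mem_of_tendsto (hasSum_incl_slice hp F)
      (Eventually.of_forall fun s => Submodule.sum_mem _ fun n _ => ?_)
    exact subset_closedSpan _ ⟨n, _, rfl⟩

end TensorCalculus

/-! ### The standard module -/

section StandardModule

variable {p q : ℝ≥0∞} [Fact (1 ≤ p)] {Ω : Type*} [MeasurableSpace Ω] {μ : Measure Ω}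
  {A : NonUnitalSubalgebra ℂ (Lp ℂ p μ →L[ℂ] Lp ℂ p μ)}
  {hA : IsClosed (A : Set (Lp ℂ p μ →L[ℂ] Lp ℂ p μ))}

theorem mem_compactTensor_of_isOpTensor {k : SeqLp p →L[ℂ] SeqLp p}
    {a : Lp ℂ p μ →L[ℂ] Lp ℂ p μ} {T : Lp ℂ p (countProd μ) →L[ℂ] Lp ℂ p (countProd μ)}
    (hk : IsCompactOperator k) (ha : a ∈ A) (hT : IsOpTensor k a T) : T ∈ compactTensor A :=
  subset_closedSpan _ ⟨k, hk, a, ha, hT⟩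

theorem truncTensor_mem_compactTensor (hp : p ≠ ⊤) (N : ℕ) {a : Lp ℂ p μ →L[ℂ] Lp ℂ p μ}
    (ha : a ∈ A) : truncTensor hp N a ∈ compactTensor A :=
  sum_mem fun n _ => mem_compactTensor_of_isOpTensor (isCompactOperator_smulRight _ _) ha
    (isOpTensor_incl_comp_slice hp n a)

theorem incl_comp_mem_X (hp : p ≠ ⊤) (n : ℕ) {a : Lp ℂ p μ →L[ℂ] Lp ℂ p μ} (ha : a ∈ A) :
    (incl hp n).comp a ∈ (standardLpModule q A hA).X :=
  subset_closedSpan _ ⟨lp.single p n 1, a, ha, fun _ => rfl⟩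

theorem comp_incl_mem_X (hp : p ≠ ⊤) (n : ℕ)
    {c : Lp ℂ p (countProd μ) →L[ℂ] Lp ℂ p (countProd μ)} (hc : c ∈ compactTensor A) :
    c.comp (incl hp n) ∈ (standardLpModule q A hA).X := by
  refine closedSpan_induct (isClosed_closedSpan _)
    ((ContinuousLinearMap.compL ℂ _ _ (Lp ℂ p (countProd μ))).flip (incl hp n)) ?_ c hc
  rintro T ⟨k, -, a, ha, hT⟩
  exact subset_closedSpan _ ⟨k (lp.single p n 1), a, ha, fun η => hT _ η⟩

/-- On generators, `slice n ∘ (k ⊗ a) = y ⊗ a` with `y` the `n`-th row of `k`; the duality `(ℓ^p)* =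
ℓ^q` puts `y` in `ℓ^q`. -/
theorem slice_comp_mem_Y (hp : p ≠ ⊤) (hpq : p.HolderConjugate q) (n : ℕ)
    {c : Lp ℂ p (countProd μ) →L[ℂ] Lp ℂ p (countProd μ)} (hc : c ∈ compactTensor A) :
    (slice n).comp c ∈ (standardLpModule q A hA).Y := by
  refine closedSpan_induct (isClosed_closedSpan _)
    (ContinuousLinearMap.compL ℂ (Lp ℂ p (countProd μ)) (Lp ℂ p (countProd μ)) (Lp ℂ p μ)
      (slice n)) ?_ c hc
  rintro T ⟨k, -, a, ha, hT⟩
  obtain ⟨y, hy⟩ := exists_tsum_mul_eq_clm hp hpq ((lp.evalCLM ℂ (fun _ : ℕ => ℂ) p n).comp k)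
  refine subset_closedSpan _ ⟨y, a, ha, fun x η => ?_⟩
  rw [← hy]
  change slice n (T (elemTensor x η)) = k x n • a η
  rw [hT, slice_elemTensor]

theorem comp_mem_compactTensor (hp : p ≠ ⊤) (hpq : p.HolderConjugate q)
    {x : Lp ℂ p μ →L[ℂ] Lp ℂ p (countProd μ)} (hx : x ∈ (standardLpModule q A hA).X)
    {y : Lp ℂ p (countProd μ) →L[ℂ] Lp ℂ p μ} (hy : y ∈ (standardLpModule q A hA).Y) :
    x.comp y ∈ compactTensor A := by
  refine closedSpan_induct₂ (isClosed_closedSpan _)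
    (ContinuousLinearMap.compL ℂ (Lp ℂ p (countProd μ)) (Lp ℂ p μ) (Lp ℂ p (countProd μ)))
    ?_ x hx y hy
  rintro S ⟨x, a, ha, hS⟩ T ⟨y, b, hb, hT⟩
  obtain ⟨φ, hφ⟩ := exists_clm_eq_tsum_mul hpq y
  refine subset_closedSpan _ ⟨φ.smulRight x, isCompactOperator_smulRight φ x, a * b,
    A.mul_mem ha hb, fun z η => ?_⟩
  change S (T (elemTensor z η)) = elemTensor (φ z • x) (a (b η))
  rw [hT, hS, ← hφ, map_smul, elemTensor_smul_left hp]

/-- `slice n` need not lie in `Y`, as `A` may lack a unit, but `(x ⊗ a) ∘ slice n` is still a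
rank-one operator tensored with `a`. -/
theorem comp_slice_mem_compactTensor (hp : p ≠ ⊤)
    {x : Lp ℂ p μ →L[ℂ] Lp ℂ p (countProd μ)} (hx : x ∈ (standardLpModule q A hA).X) (n : ℕ) :
    x.comp (slice n) ∈ compactTensor A := by
  refine closedSpan_induct (isClosed_closedSpan _)
    ((ContinuousLinearMap.compL ℂ (Lp ℂ p (countProd μ)) (Lp ℂ p μ)
      (Lp ℂ p (countProd μ))).flip (slice n)) ?_ x hx
  rintro T ⟨x, a, ha, hT⟩
  refine subset_closedSpan _ ⟨(lp.evalCLM ℂ (fun _ : ℕ => ℂ) p n).smulRight x,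
    isCompactOperator_smulRight _ x, a, ha, fun z η => ?_⟩
  change T (slice n (elemTensor z η)) = elemTensor (z n • x) (a η)
  rw [slice_elemTensor, hT, map_smul, elemTensor_smul_left hp]

theorem incl_comp_mem_compactTensor (hp : p ≠ ⊤) (hpq : p.HolderConjugate q)
    {y : Lp ℂ p (countProd μ) →L[ℂ] Lp ℂ p μ} (hy : y ∈ (standardLpModule q A hA).Y) (n : ℕ) :
    (incl hp n).comp y ∈ compactTensor A := by
  refine closedSpan_induct (isClosed_closedSpan _)
    (ContinuousLinearMap.compL ℂ (Lp ℂ p (countProd μ)) (Lp ℂ p μ) (Lp ℂ p (countProd μ))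
      (incl hp n)) ?_ y hy
  rintro T ⟨y, b, hb, hT⟩
  obtain ⟨φ, hφ⟩ := exists_clm_eq_tsum_mul hpq y
  refine subset_closedSpan _ ⟨φ.smulRight (lp.single p n 1 : SeqLp p),
    isCompactOperator_smulRight _ _, b, hb, fun z η => ?_⟩
  change incl hp n (T (elemTensor z η)) = elemTensor (φ z • (lp.single p n 1 : SeqLp p)) (b η)
  rw [hT, ← hφ, incl_apply, elemTensor_smul_left hp]

theorem compacts_standardLpModule (hp : p ≠ ⊤) (hpq : p.HolderConjugate q)
    (hcai : HasContractiveApproxId A) :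
    (standardLpModule q A hA).compacts = compactTensor A := by
  obtain ⟨Λ, _, _, _, e, he, hea⟩ := hcai
  refine le_antisymm (fun t ht => ?_) (fun t ht => ?_)
  · refine closedSpan_induct (isClosed_closedSpan _) (ContinuousLinearMap.id ℂ _) ?_ t ht
    rintro _ ⟨x, hx, y, hy, rfl⟩
    exact comp_mem_compactTensor hp hpq hx hy
  · refine closedSpan_induct (isClosed_closedSpan _) (ContinuousLinearMap.id ℂ _) ?_ t ht
    rintro T ⟨k, hk, a, ha, hT⟩
    have hTB := mem_compactTensor_of_isOpTensor hk ha hT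
    refine (isClosed_closedSpan _).mem_of_tendsto
      (hT.tendsto_truncTensor_mul hp (hea a ha).2 hk) (Eventually.of_forall fun i => ?_)
    -- Each summand is bracketed as `(incl n ∘ e) ∘ (slice n ∘ T)`, a product of an element of `X`
    -- and an element of `Y`.
    rw [truncTensor, Finset.sum_mul]
    refine Submodule.sum_mem _ fun n _ => subset_closedSpan _ ?_
    exact ⟨_, incl_comp_mem_X hp n (he i.2).1, _, slice_comp_mem_Y hp hpq n hTB, rfl⟩

theorem morphisms_standardLpModule (hp : p ≠ ⊤) (hpq : p.HolderConjugate q)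
    (hcai : HasContractiveApproxId A) :
    ((standardLpModule q A hA).morphisms :
        Set (Lp ℂ p (countProd μ) →L[ℂ] Lp ℂ p (countProd μ))) =
      {t | ∀ c ∈ compactTensor A, t * c ∈ compactTensor A ∧ c * t ∈ compactTensor A} := by
  -- One slice suffices to pass between the module and `B`; the index `0` is arbitrary.
  have hsi : (slice 0).comp (incl hp 0) = ContinuousLinearMap.id ℂ (Lp ℂ p μ) := by
    ext1 η
    simp [slice_incl]
  ext t
  constructor
  · intro ht
    have hK := compacts_standardLpModule (hA := hA) hp hpq hcai
    intro c hc
    rw [← hK] at hc ⊢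
    constructor
    · refine closedSpan_induct (isClosed_closedSpan _) (ContinuousLinearMap.mul ℂ _ t) ?_ c hc
      rintro _ ⟨x, hx, y, hy, rfl⟩
      exact subset_closedSpan _ ⟨t.comp x, ht.1 x hx, y, hy, rfl⟩
    · refine closedSpan_induct (isClosed_closedSpan _)
        ((ContinuousLinearMap.mul ℂ _).flip t) ?_ c hc
      rintro _ ⟨x, hx, y, hy, rfl⟩
      exact subset_closedSpan _ ⟨x, hx, y.comp t, ht.2 y hy, rfl⟩
  · intro ht
    refine ⟨fun x hx => ?_, fun y hy => ?_⟩
    -- The element `x` is lifted to `x ∘ slice 0` in `B`, multiplied by `t` there, and brought back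
    -- to `X` by `incl 0`.
    · have h := comp_incl_mem_X (q := q) (hA := hA) hp 0
        (ht _ (comp_slice_mem_compactTensor hp hx 0)).1
      have h' : (t * x.comp (slice 0)).comp (incl hp 0) = t.comp x := by
        rw [ContinuousLinearMap.mul_def, ContinuousLinearMap.comp_assoc,
          ContinuousLinearMap.comp_assoc, hsi, ContinuousLinearMap.comp_id]
      rwa [h'] at h
    · have h := slice_comp_mem_Y (hA := hA) hp hpq 0
        (ht _ (incl_comp_mem_compactTensor hp hpq hy 0)).2
      have h' : (slice 0).comp ((incl hp 0).comp y * t) = y.comp t := by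
        rw [ContinuousLinearMap.mul_def, ← ContinuousLinearMap.comp_assoc,
          ← ContinuousLinearMap.comp_assoc, hsi, ContinuousLinearMap.id_comp]
      rwa [h'] at h

/-- The operators `P_N ⊗ e` are contractions, so convergence on the generators `k ⊗ a` extends to
their closed span. -/
theorem tendsto_truncTensor_mul_of_mem {Λ : Type*} {l : Filter Λ} (hp : p ≠ ⊤)
    {e : Λ → Lp ℂ p μ →L[ℂ] Lp ℂ p μ} (he : ∀ i, ‖e i‖ ≤ 1)
    (hea : ∀ a ∈ A, Tendsto (fun i => ‖e i * a - a‖) l (𝓝 0))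
    {c : Lp ℂ p (countProd μ) →L[ℂ] Lp ℂ p (countProd μ)} (hc : c ∈ compactTensor A) :
    Tendsto (fun i : ℕ × Λ => truncTensor hp i.1 (e i.2) * c) (atTop ×ˢ l) (𝓝 c) := by
  refine tendsto_of_mem_closedSpan (C := 1)
    (g := fun i : ℕ × Λ => ContinuousLinearMap.mul ℂ _ (truncTensor hp i.1 (e i.2)))
    (fun i => (ContinuousLinearMap.opNorm_mul_apply_le _ _ _).trans
      ((norm_truncTensor_le hp _ _).trans (he _))) (ContinuousLinearMap.id ℂ _) ?_ c hc
  rintro T ⟨k, hk, a, ha, hT⟩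
  exact hT.tendsto_truncTensor_mul hp (hea a ha) hk

end StandardModule

end

theorem mainTheorem4 (p q : ℝ≥0∞) [Fact (1 ≤ p)] (hp : p ≠ ⊤) (hpq : p.HolderConjugate q)
    {Ω : Type*} [MeasurableSpace Ω] (μ : Measure Ω)
    (A : NonUnitalSubalgebra ℂ (Lp ℂ p μ →L[ℂ] Lp ℂ p μ))
    (hA : IsClosed (A : Set (Lp ℂ p μ →L[ℂ] Lp ℂ p μ)))
    (hcai : HasContractiveApproxId A) :
    (standardLpModule q A hA).compacts = compactTensor A ∧
    (IsNondegenerate A →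
      ((standardLpModule q A hA).morphisms :
          Set (Lp ℂ p (countProd μ) →L[ℂ] Lp ℂ p (countProd μ))) =
        {t | ∀ c ∈ compactTensor A, t * c ∈ compactTensor A ∧ c * t ∈ compactTensor A} ∧
      ∃ Φ : (standardLpModule q A hA).morphisms ≃ₐ[ℂ] MultiplierAlgebra (compactTensor A),
        (∀ t, ‖Φ t‖ = ‖t‖) ∧
        ∀ t (c : compactTensor A),
          ((Φ t).left c : Lp ℂ p (countProd μ) →L[ℂ] Lp ℂ p (countProd μ)) = t.1 * c ∧
          ((Φ t).right c : Lp ℂ p (countProd μ) →L[ℂ] Lp ℂ p (countProd μ)) = c * t.1) := by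
  refine ⟨compacts_standardLpModule hp hpq hcai, fun hnd => ?_⟩
  have hmor := morphisms_standardLpModule (hA := hA) hp hpq hcai
  refine ⟨hmor, ?_⟩
  obtain ⟨Λ, _, _, _, e, he, hea⟩ := hcai
  have hne : ∀ i, ‖e i‖ ≤ 1 := fun i => (he i).2
  have hle : ∀ a ∈ A, Tendsto (fun i => ‖e i * a - a‖) atTop (𝓝 0) := fun a ha => (hea a ha).2
  -- The approximate identity `P_N ⊗ e_λ` is taken along the product filter, nontrivial because the
  -- index set of `e` is directed and nonempty.
  refine exists_algEquiv_multiplierAlgebra (l := (atTop : Filter ℕ) ×ˢ (atTop : Filter Λ))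
    (f := fun i => ⟨truncTensor hp i.1 (e i.2), truncTensor_mem_compactTensor hp i.1 (he i.2).1⟩)
    (fun i => (norm_truncTensor_le hp _ _).trans (hne _)) (fun b => ?_)
    (tendsto_truncTensor_apply hp hnd hne hle) _ hmor
  exact tendsto_subtype_rng.2 (tendsto_truncTensor_mul_of_mem hp hne hle b.2)
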